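/- For integers $r \ge 3$ and $t \ge 2$, an $r$-uniform $t$-daisy $\mathcal D_r^t$ is a family of $\binom{2t}{t}$ $r$-element sets of the form $\{S \cup T : T \subset U,\ |T| = t\}$ for some disjoint sets $S, U$ with $|S| = r-t$ and $|U| = 2t$ (there are none when $r < t$). Let $\mathrm{ex}(n, \mathcal D_r^t)$ be the maximum cardinality of a family of $r$-element subsets of $\{1, \dots, n\}$ that contains no $r$-uniform $t$-daisy, and let $$\pi(\mathcal D_r^t) = \lim_{n \to \infty} \frac{\mathrm{ex}(n, \mathcal D_r^t)}{\binom nr},$$ a limit that always exists. There is an absolute constant $c > 0$ such that $\pi(\mathcal D_r^2) \ge c/r$ for all $r \ge 3$. Furthermore, there is an absolute constant $C > 0$ such that for all $t \ge 3$ and all $r \ge 3$, $$\pi(\mathcal D_r^t) \ge r^{-\frac{4t-2}{\binom{2t}{t}-1} - \frac{C}{\sqrt{\log r}}}.$$ -/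

import Mathlib

open Filter Topology

/-- The family `{S ∪ T : T ⊆ U, |T| = t}`. -/
def daisy {α : Type*} [DecidableEq α] (t : ℕ) (S U : Finset α) : Finset (Finset α) :=
  (U.powersetCard t).image fun T => S ∪ T

/-- `D` is an `r`-uniform `t`-daisy: `D = {S ∪ T : T ⊆ U, |T| = t}` for some disjoint `S`, `U`
with `|S| = r - t` and `|U| = 2t`. The condition `|S| = r - t` is written without natural-number
subtraction, so that it cannot be met when `r < t`. -/
def IsDaisy {α : Type*} [DecidableEq α] (r t : ℕ) (D : Finset (Finset α)) : Prop :=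
  ∃ S U : Finset α, S.card + t = r ∧ U.card = 2 * t ∧ Disjoint S U ∧ D = daisy t S U

/-- A family of finite sets is daisy-free if no subfamily of it is an `r`-uniform `t`-daisy. -/
def IsDaisyFree {α : Type*} [DecidableEq α] (r t : ℕ) (F : Finset (Finset α)) : Prop :=
  ∀ D : Finset (Finset α), D ⊆ F → ¬ IsDaisy r t D

open scoped Classical in
/-- The Turán number `ex(n, D_r^t)`: the largest cardinality of a daisy-free family of `r`-element
subsets of an `n`-element set. -/
noncomputable def daisyEx (n r t : ℕ) : ℕ :=
  (((Finset.univ : Finset (Fin n)).powersetCard r).powerset.filter fun F => IsDaisyFree r t F).sup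
    Finset.card

/-- The Turán density `π(D_r^t) = lim_{n → ∞} ex(n, D_r^t) / C(n, r)`. The limit exists, see
`tendsto_daisyDensity` below. -/
noncomputable def daisyDensity (r t : ℕ) : ℝ :=
  limUnder atTop fun n : ℕ => (daisyEx n r t : ℝ) / (n.choose r : ℝ)

theorem card_le_daisyEx {n r t : ℕ} {F : Finset (Finset (Fin n))}
    (hF : ∀ A ∈ F, A.card = r) (h : IsDaisyFree r t F) : F.card ≤ daisyEx n r t := by
  classical
  unfold daisyEx
  refine Finset.le_sup (f := Finset.card) ?_
  rw [Finset.mem_filter, Finset.mem_powerset]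
  exact ⟨fun A hA => Finset.mem_powersetCard.2 ⟨Finset.subset_univ _, hF A hA⟩, h⟩

theorem exists_card_eq_daisyEx (n r t : ℕ) : ∃ F : Finset (Finset (Fin n)),
    (∀ A ∈ F, A.card = r) ∧ IsDaisyFree r t F ∧ F.card = daisyEx n r t := by
  classical
  have hne : (((Finset.univ : Finset (Fin n)).powersetCard r).powerset.filter
      fun F => IsDaisyFree r t F).Nonempty := by
    refine ⟨∅, ?_⟩
    rw [Finset.mem_filter]
    refine ⟨Finset.empty_mem_powerset _, ?_⟩
    rintro D hD ⟨S, U, -, hU, -, rfl⟩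
    have h1 : (U.powersetCard t).Nonempty := Finset.powersetCard_nonempty.2 (by omega)
    have h2 := (h1.image fun T => S ∪ T).mono hD
    exact Finset.not_nonempty_empty h2
  obtain ⟨F, hF, hc⟩ := Finset.exists_mem_eq_sup _ hne Finset.card
  rw [Finset.mem_filter, Finset.mem_powerset] at hF
  exact ⟨F, fun A hA => (Finset.mem_powersetCard.1 (hF.1 hA)).2, hF.2, hc.symm⟩

theorem daisyEx_succ_mul_le (n r t : ℕ) :
    (n + 1 - r) * daisyEx (n + 1) r t ≤ (n + 1) * daisyEx n r t := by
  classical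
  obtain ⟨F, hF, hfree, hc⟩ := exists_card_eq_daisyEx (n + 1) r t
  let e : Fin (n + 1) → Fin n ↪ Fin (n + 1) := fun i => i.succAboveEmb
  let G : Fin (n + 1) → Finset (Finset (Fin n)) := fun i =>
    Finset.univ.filter fun A => A.map (e i) ∈ F
  have hG : ∀ i, (G i).card ≤ daisyEx n r t := by
    intro i
    refine card_le_daisyEx ?_ ?_
    · intro A hA
      rw [← Finset.card_map (e i)]
      exact hF _ (Finset.mem_filter.1 hA).2
    · rintro D hD ⟨S, U, hS, hU, hd, rfl⟩
      refine hfree (daisy t (S.map (e i)) (U.map (e i))) ?_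
        ⟨_, _, by rwa [Finset.card_map], by rwa [Finset.card_map],
          (Finset.disjoint_map _).2 hd, rfl⟩
      intro A hA
      obtain ⟨T, hT, rfl⟩ := Finset.mem_image.1 hA
      rw [Finset.powersetCard_map, Finset.mem_map] at hT
      obtain ⟨T', hT', rfl⟩ := hT
      have := hD (Finset.mem_image_of_mem (fun T => S ∪ T) hT')
      have h2 := (Finset.mem_filter.1 this).2
      simpa [Finset.map_union] using h2
  have hcard : ∀ i, (G i).card = (F.filter fun A => i ∉ A).card := by
    intro i
    refine Finset.card_bij (fun A _ => A.map (e i)) ?_ ?_ ?_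
    · intro A hA
      rw [Finset.mem_filter]
      refine ⟨(Finset.mem_filter.1 hA).2, ?_⟩
      simp [e, Fin.succAbove_ne]
    · intro A _ B _ h
      exact Finset.map_injective _ h
    · intro B hB
      rw [Finset.mem_filter] at hB
      have : (Finset.univ.filter fun a => e i a ∈ B).map (e i) = B := by
        ext x
        simp only [Finset.mem_map, Finset.mem_filter, Finset.mem_univ, true_and]
        constructor
        · rintro ⟨a, ha, rfl⟩
          exact ha
        · intro hx
          obtain ⟨a, ha⟩ := Fin.exists_succAbove_eq (x := x) (y := i)
            (fun h => hB.2 (h ▸ hx))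
          have hea : e i a = x := ha
          exact ⟨a, hea ▸ hx, hea⟩
      refine ⟨_, ?_, this⟩
      simp only [G, Finset.mem_filter, Finset.mem_univ, true_and]
      rw [this]
      exact hB.1
  have hsum : ∑ i, (G i).card = (n + 1 - r) * F.card := by
    simp_rw [hcard, Finset.card_filter]
    rw [Finset.sum_comm]
    have : ∀ A ∈ F, (∑ i : Fin (n + 1), if i ∉ A then 1 else 0) = n + 1 - r := by
      intro A hA
      rw [← Finset.card_filter, ← hF A hA, ← Finset.compl_filter]
      simp [Finset.card_compl]
    rw [Finset.sum_congr rfl this, Finset.sum_const, smul_eq_mul, mul_comm]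
  rw [← hc, ← hsum]
  calc ∑ i, (G i).card ≤ ∑ _i : Fin (n + 1), daisyEx n r t := Finset.sum_le_sum fun i _ => hG i
    _ = (n + 1) * daisyEx n r t := by simp

/-- The limit that defines the Turán density exists. -/
theorem tendsto_daisyDensity (r t : ℕ) :
    Tendsto (fun n : ℕ => (daisyEx n r t : ℝ) / (n.choose r : ℝ)) atTop
      (𝓝 (daisyDensity r t)) := by
  refine tendsto_nhds_limUnder ?_
  let f : ℕ → ℝ := fun n => (daisyEx (n + r) r t : ℝ) / ((n + r).choose r : ℝ)
  have hanti : Antitone f := by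
    refine antitone_nat_of_succ_le fun n => ?_
    have h1 := daisyEx_succ_mul_le (n + r) r t
    have h2 := Nat.choose_mul_succ_eq (n + r) r
    have h3 : n + r + 1 - r = n + 1 := by omega
    rw [h3] at h1 h2
    have p1 : (0 : ℝ) < ((n + r).choose r : ℝ) := by
      exact_mod_cast Nat.choose_pos (by omega)
    have p2 : (0 : ℝ) < ((n + r + 1).choose r : ℝ) := by
      exact_mod_cast Nat.choose_pos (by omega)
    have h1' : ((n : ℝ) + 1) * daisyEx (n + r + 1) r t ≤ (n + r + 1) * daisyEx (n + r) r t := by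
      exact_mod_cast h1
    have h2' : ((n + r).choose r : ℝ) * (n + r + 1) = ((n + r + 1).choose r : ℝ) * (n + 1) := by
      exact_mod_cast h2
    have e1 : n + 1 + r = n + r + 1 := by omega
    change (daisyEx (n + 1 + r) r t : ℝ) / ((n + 1 + r).choose r : ℝ) ≤ _
    rw [e1, div_le_div_iff₀ p2 p1]
    have hn : (0 : ℝ) < n + 1 := by positivity
    refine le_of_mul_le_mul_left ?_ hn
    calc ((n : ℝ) + 1) * (daisyEx (n + r + 1) r t * ((n + r).choose r : ℝ))
        = (((n : ℝ) + 1) * daisyEx (n + r + 1) r t) * ((n + r).choose r : ℝ) := by ring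
      _ ≤ ((n + r + 1) * daisyEx (n + r) r t) * ((n + r).choose r : ℝ) := by gcongr
      _ = daisyEx (n + r) r t * (((n + r).choose r : ℝ) * (n + r + 1)) := by ring
      _ = (n + 1) * (daisyEx (n + r) r t * ((n + r + 1).choose r : ℝ)) := by rw [h2']; ring
  have hbdd : BddBelow (Set.range f) := ⟨0, by rintro _ ⟨n, rfl⟩; positivity⟩
  exact ⟨_, (tendsto_add_atTop_iff_nat r).1 (tendsto_atTop_ciInf hanti hbdd)⟩

/-!
The density `daisyDensity r t` is at least `1/4` for all `r` and all `t ≥ 2`, which is stronger than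
both claims. Take a map `f : Fin n → 𝔽₂^r` and the family of all `r`-sets on which `f` is linearly
independent, that is, whose images are bases.

This family is daisy-free (`isDaisyFree_of_linearIndepOn`). In a daisy with stem `S`, the quotient
by the span of `f '' S` is `𝔽₂^t`, and `U` would give `2t` vectors in it, any `t` of which form a
basis. Take `t` of them as the standard basis: each of the remaining `t ≥ 2` vectors has only
nonzero coordinates, hence is the all-ones vector, and two equal vectors do not extend to a basis.

For a uniformly random `f`, an `r`-set belongs to the family with probability
`∏_{k=1}^{r} (1 - 2^{-k}) ≥ 1/4` (`card_fun_le_four_mul_card_linearIndepOn`), so some `f` gives a family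
of at least a quarter of all `r`-sets (`choose_le_four_mul_daisyEx`).

For the second claim, `r ^ (-2 / √(log r)) = exp (-2 √(log r)) ≤ exp (-2) ≤ 1/4` once `r ≥ 3`, and
the remaining part of the exponent is not positive.
-/

/-! ### Daisy-freeness of families of bases over the two-element field -/

/-- If `f` maps `S ∪ T` to a basis for every `t`-set `T ⊆ U`, then, modulo the span of `f '' S`, an
element `x ∈ U` outside a `t`-set `T₀ ⊆ U` is the sum of the elements of `T₀`: a vanishing
coordinate at `i ∈ T₀` would make `S ∪ (T₀ \ {i} ∪ {x})` dependent. -/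
theorem sub_sum_mem_span_of_forall_linearIndepOn {α : Type*} [DecidableEq α] {r t : ℕ}
    {f : α → Fin r → ZMod 2} {S U T₀ : Finset α} (hS : S.card + t = r) (hd : Disjoint S U)
    (hf : ∀ T ⊆ U, T.card = t → LinearIndepOn (ZMod 2) f (S ∪ T : Finset α))
    (hT₀ : T₀ ⊆ U) (hc : T₀.card = t) {x : α} (hx : x ∈ U) (hxT : x ∉ T₀) :
    f x - ∑ i ∈ T₀, f i ∈ Submodule.span (ZMod 2) (f '' S) := by
  have hd₀ : Disjoint S T₀ := hd.mono_right hT₀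
  have hspan : Submodule.span (ZMod 2) (f '' (S ∪ T₀ : Finset α)) = ⊤ := by
    have h1 : LinearIndependent (ZMod 2) fun i : (S ∪ T₀ : Finset α) => f i := hf T₀ hT₀ hc
    have h2 := h1.span_eq_top_of_card_eq_finrank' (by
      rw [Fintype.card_coe, Finset.card_union_of_disjoint hd₀, Module.finrank_fin_fun]; omega)
    rw [← h2]
    congr 1
    ext v
    simp
  have hmem : f x ∈ Submodule.span (ZMod 2) (f '' (S ∪ T₀ : Finset α)) := hspan ▸ trivial
  obtain ⟨c, hcx⟩ := (Submodule.mem_span_image_finset_iff_exists_fun' (ZMod 2)).1 hmem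
  have hone : ∀ i ∈ T₀, c i = 1 := by
    intro i hi
    by_contra hci
    have hzero : c i = 0 := by
      generalize c i = a at hci
      revert a
      decide
    have hcard : (insert x (T₀.erase i)).card = t := by
      rw [Finset.card_insert_of_notMem (fun h => hxT (Finset.mem_of_mem_erase h)),
        Finset.card_erase_of_mem hi, hc]
      have := Finset.card_pos.2 ⟨i, hi⟩
      omega
    have hli := hf (insert x (T₀.erase i))
      (Finset.insert_subset hx ((Finset.erase_subset _ _).trans hT₀)) hcard
    have hxS : x ∉ (S ∪ T₀.erase i : Finset α) := by
      rw [Finset.mem_union, not_or]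
      exact ⟨fun h => Finset.disjoint_left.1 hd h hx, fun h => hxT (Finset.mem_of_mem_erase h)⟩
    rw [Finset.union_insert, Finset.coe_insert,
      linearIndepOn_insert (by exact_mod_cast hxS)] at hli
    refine hli.2 ?_
    rw [← hcx]
    refine Submodule.sum_mem _ fun j hj => ?_
    rcases eq_or_ne j i with rfl | hji
    · simp [hzero]
    · refine Submodule.smul_mem _ _ (Submodule.subset_span ⟨j, ?_, rfl⟩)
      have : j ∈ S ∪ T₀.erase i := by
        rw [Finset.mem_union] at hj ⊢
        exact hj.imp_right fun h => Finset.mem_erase.2 ⟨hji, h⟩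
      exact_mod_cast this
  have hsum : f x = ∑ i ∈ S, c i • f i + ∑ i ∈ T₀, f i := by
    rw [← hcx, Finset.sum_union hd₀]
    congr 1
    exact Finset.sum_congr rfl fun i hi => by rw [hone i hi, one_smul]
  rw [hsum, add_sub_cancel_right]
  exact Submodule.sum_mem _ fun i hi =>
    Submodule.smul_mem _ _ (Submodule.subset_span ⟨i, hi, rfl⟩)

theorem isDaisyFree_of_linearIndepOn {α : Type*} [DecidableEq α] {r t : ℕ} (ht : 2 ≤ t)
    (f : α → Fin r → ZMod 2) {F : Finset (Finset α)}
    (hF : ∀ A ∈ F, LinearIndepOn (ZMod 2) f (A : Set α)) : IsDaisyFree r t F := by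
  rintro D hD ⟨S, U, hS, hU, hd, rfl⟩
  have hf : ∀ T ⊆ U, T.card = t → LinearIndepOn (ZMod 2) f (S ∪ T : Finset α) :=
    fun T hT hc => hF _ (hD (Finset.mem_image_of_mem _ (Finset.mem_powersetCard.2 ⟨hT, hc⟩)))
  obtain ⟨T₀, hT₀, hc⟩ := Finset.exists_subset_card_eq (show t ≤ U.card by omega)
  have hdiff : 1 < (U \ T₀).card := by
    rw [Finset.card_sdiff_of_subset hT₀]
    omega
  obtain ⟨x, hx, y, hy, hxy⟩ := Finset.one_lt_card.1 hdiff
  rw [Finset.mem_sdiff] at hx hy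
  have hsub : f x - f y ∈ Submodule.span (ZMod 2) (f '' S) := by
    have h := Submodule.sub_mem _
      (sub_sum_mem_span_of_forall_linearIndepOn hS hd hf hT₀ hc hx.1 hx.2)
      (sub_sum_mem_span_of_forall_linearIndepOn hS hd hf hT₀ hc hy.1 hy.2)
    rwa [sub_sub_sub_cancel_right] at h
  -- `x` and `y` agree modulo the span of `S`, so no `t`-set containing both can be independent.
  obtain ⟨T₁, hT₁, hc₁⟩ := Finset.exists_subset_card_eq (show t - 2 ≤ T₀.card by omega)
  have hyT : y ∉ T₁ := fun h => hy.2 (hT₁ h)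
  have hxT : x ∉ insert y T₁ := by
    rw [Finset.mem_insert, not_or]
    exact ⟨hxy, fun h => hx.2 (hT₁ h)⟩
  have hli := hf (insert x (insert y T₁))
    (Finset.insert_subset hx.1 (Finset.insert_subset hy.1 (hT₁.trans hT₀)))
    (by rw [Finset.card_insert_of_notMem hxT, Finset.card_insert_of_notMem hyT, hc₁]; omega)
  have hxS : x ∉ S ∪ insert y T₁ := by
    rw [Finset.mem_union, not_or]
    exact ⟨fun h => Finset.disjoint_left.1 hd h hx.1, hxT⟩
  rw [Finset.union_insert, Finset.coe_insert, linearIndepOn_insert (by exact_mod_cast hxS)] at hli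
  refine hli.2 ?_
  rw [← sub_add_cancel (f x) (f y)]
  refine Submodule.add_mem _ (Submodule.span_mono (Set.image_mono ?_) hsub)
    (Submodule.subset_span ⟨y, by simp, rfl⟩)
  exact_mod_cast Finset.subset_union_left

/-! ### The probability that random vectors form a basis -/

/-- The induction needs the surplus `1 / 2 ^ (r + 1)`, since the bound `1/4` alone is not preserved
by the next factor. -/
theorem quarter_add_le_prod_one_sub_half_pow (r : ℕ) (hr : 1 ≤ r) :
    (1 / 4 : ℝ) + (1 / 2) ^ (r + 1) ≤ ∏ k ∈ Finset.range r, (1 - (1 / 2 : ℝ) ^ (k + 1)) := by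
  induction r, hr using Nat.le_induction with
  | base => norm_num
  | succ r hr ih =>
    rw [Finset.prod_range_succ]
    have hx : (1 / 2 : ℝ) ^ (r + 1) ≤ (1 / 2) ^ 2 :=
      pow_le_pow_of_le_one (by norm_num) (by norm_num) (by omega)
    have hx0 : (0 : ℝ) < (1 / 2) ^ (r + 1) := by positivity
    rw [pow_succ (1 / 2 : ℝ) (r + 1)]
    generalize (1 / 2 : ℝ) ^ (r + 1) = x at *
    nlinarith [mul_le_mul_of_nonneg_right ih (show 0 ≤ 1 - x by linarith)]

theorem quarter_le_prod_one_sub_half_pow (r : ℕ) :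
    (1 / 4 : ℝ) ≤ ∏ k ∈ Finset.range r, (1 - (1 / 2 : ℝ) ^ (k + 1)) := by
  rcases Nat.eq_zero_or_pos r with rfl | hr
  · norm_num
  · have := quarter_add_le_prod_one_sub_half_pow r hr
    have h0 : (0 : ℝ) < (1 / 2) ^ (r + 1) := by positivity
    linarith

theorem pow_le_four_mul_prod_two_pow_sub (r : ℕ) :
    (2 ^ r) ^ r ≤ 4 * ∏ i : Fin r, (2 ^ r - 2 ^ (i : ℕ)) := by
  have key : ((∏ i : Fin r, (2 ^ r - 2 ^ (i : ℕ)) : ℕ) : ℝ)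
      = (2 ^ r) ^ r * ∏ k ∈ Finset.range r, (1 - (1 / 2 : ℝ) ^ (k + 1)) := by
    rw [Fin.prod_univ_eq_prod_range (fun i => 2 ^ r - 2 ^ i) r, ← Finset.prod_range_reflect]
    have hpow : ((2 : ℝ) ^ r) ^ r = ∏ _k ∈ Finset.range r, (2 : ℝ) ^ r := by simp
    rw [hpow, ← Finset.prod_mul_distrib, Nat.cast_prod]
    refine Finset.prod_congr rfl fun k hk => ?_
    have hk' := Finset.mem_range.1 hk
    rw [Nat.cast_sub (Nat.pow_le_pow_right (by norm_num) (by omega))]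
    have hsplit : (2 : ℝ) ^ r = 2 ^ (r - 1 - k) * 2 ^ (k + 1) := by
      rw [← pow_add]
      congr 1
      omega
    push_cast
    rw [mul_sub, mul_one, hsplit, mul_assoc, ← mul_pow]
    norm_num
  have h := quarter_le_prod_one_sub_half_pow r
  have h2 : (0 : ℝ) < (2 ^ r) ^ r := by positivity
  have : (((2 ^ r) ^ r : ℕ) : ℝ) ≤ ((4 * ∏ i : Fin r, (2 ^ r - 2 ^ (i : ℕ)) : ℕ) : ℝ) := by
    rw [Nat.cast_mul, key]
    push_cast
    nlinarith [mul_le_mul_of_nonneg_left h h2.le]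
  exact_mod_cast this

/-- A random map to a vector space of dimension `r` over `𝔽₂` is linearly independent on a given
`r`-set with probability at least `1/4`. -/
theorem card_fun_le_four_mul_card_linearIndepOn {α V : Type*} [Fintype α] [DecidableEq α]
    [Fintype V] [AddCommGroup V] [Module (ZMod 2) V] {r : ℕ}
    (hr : Module.finrank (ZMod 2) V = r) {A : Finset α} (hA : A.card = r)
    [∀ f : α → V, Decidable (LinearIndepOn (ZMod 2) f (A : Set α))] :
    Fintype.card (α → V) ≤ 4 * (Finset.univ.filter fun f : α → V =>
      LinearIndepOn (ZMod 2) f (A : Set α)).card := by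
  classical
  let e : (α → V) ≃ ({a // a ∈ A} → V) × ({a // a ∉ A} → V) :=
    Equiv.piEquivPiSubtypeProd (fun a => a ∈ A) fun _ => V
  let σ : {a // a ∈ A} ≃ Fin r := Fintype.equivFinOfCardEq (by rw [Fintype.card_coe, hA])
  have hV : Fintype.card V = 2 ^ r := by
    rw [Module.card_eq_pow_finrank (K := ZMod 2), ZMod.card, hr]
  have hli : Fintype.card {g : {a // a ∈ A} → V // LinearIndependent (ZMod 2) g}
      = ∏ i : Fin r, (2 ^ r - 2 ^ (i : ℕ)) := by
    have h := card_linearIndependent (K := ZMod 2) (V := V) (k := r) hr.ge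
    rw [hr, ZMod.card] at h
    rw [← h, ← Nat.card_eq_fintype_card]
    refine Nat.card_congr ((σ.arrowCongr (Equiv.refl V)).subtypeEquiv fun g => ?_)
    exact (linearIndependent_equiv σ.symm (f := g)).symm
  have hfil : (Finset.univ.filter fun f : α → V => LinearIndepOn (ZMod 2) f (A : Set α)).card
      = Fintype.card {g : {a // a ∈ A} → V // LinearIndependent (ZMod 2) g}
        * Fintype.card ({a // a ∉ A} → V) := by
    rw [← Fintype.card_subtype, ← Fintype.card_prod]
    refine Fintype.card_congr ((e.subtypeEquiv (q := fun p =>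
      LinearIndependent (ZMod 2) p.1) fun f => Iff.rfl).trans ?_)
    exact Equiv.prodSubtypeFstEquivSubtypeProd (p := fun g => LinearIndependent (ZMod 2) g)
  rw [hfil, hli, Fintype.card_congr e, Fintype.card_prod, ← mul_assoc]
  refine Nat.mul_le_mul_right _ ?_
  rw [Fintype.card_fun, hV, Fintype.card_coe, hA]
  exact pow_le_four_mul_prod_two_pow_sub r

/-! ### The density bound -/

theorem choose_le_four_mul_daisyEx (n r t : ℕ) (ht : 2 ≤ t) :
    n.choose r ≤ 4 * daisyEx n r t := by
  classical
  let V := Fin r → ZMod 2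
  let P : Finset (Finset (Fin n)) := Finset.univ.powersetCard r
  let G : (Fin n → V) → Finset (Finset (Fin n)) := fun f =>
    P.filter fun A => LinearIndepOn (ZMod 2) f (A : Set (Fin n))
  have hG : ∀ f, (G f).card ≤ daisyEx n r t := fun f =>
    card_le_daisyEx (fun A hA => (Finset.mem_powersetCard.1 (Finset.mem_filter.1 hA).1).2)
      (isDaisyFree_of_linearIndepOn ht f fun A hA => (Finset.mem_filter.1 hA).2)
  have hP : P.card = n.choose r := by simp [P]
  -- Double counting of the pairs `(f, A)` with `f` linearly independent on `A`.
  have hcount : ∑ f, (G f).card = ∑ A ∈ P, (Finset.univ.filter fun f : Fin n → V =>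
      LinearIndepOn (ZMod 2) f (A : Set (Fin n))).card := by
    simp_rw [G, Finset.card_filter]
    exact Finset.sum_comm
  have h1 : P.card * Fintype.card (Fin n → V) ≤ 4 * ∑ f, (G f).card := by
    rw [hcount, Finset.mul_sum, ← smul_eq_mul, ← Finset.sum_const]
    refine Finset.sum_le_sum fun A hA => ?_
    exact card_fun_le_four_mul_card_linearIndepOn (Module.finrank_fin_fun _)
      (Finset.mem_powersetCard.1 hA).2
  have h2 : ∑ f, (G f).card ≤ Fintype.card (Fin n → V) * daisyEx n r t := by
    calc ∑ f, (G f).card ≤ ∑ _f : Fin n → V, daisyEx n r t :=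
          Finset.sum_le_sum fun f _ => hG f
      _ = _ := by rw [Finset.sum_const, Finset.card_univ, smul_eq_mul]
  have hpos : 0 < Fintype.card (Fin n → V) := Fintype.card_pos
  rw [← hP]
  refine Nat.le_of_mul_le_mul_right ?_ hpos
  calc _ ≤ 4 * (Fintype.card (Fin n → V) * daisyEx n r t) := h1.trans (by gcongr)
    _ = _ := by ring

theorem quarter_le_daisyDensity (r t : ℕ) (ht : 2 ≤ t) : 1 / 4 ≤ daisyDensity r t := by
  refine ge_of_tendsto (tendsto_daisyDensity r t) ?_
  filter_upwards [eventually_ge_atTop r] with n hn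
  have hpos : (0 : ℝ) < n.choose r := by exact_mod_cast Nat.choose_pos hn
  have h : (n.choose r : ℝ) ≤ 4 * daisyEx n r t := by
    exact_mod_cast choose_le_four_mul_daisyEx n r t ht
  rw [le_div_iff₀ hpos]
  linarith

theorem rpow_neg_sub_two_div_sqrt_log_le {x a : ℝ} (hx : 3 ≤ x) (ha : 0 ≤ a) :
    x ^ (-a - 2 / Real.sqrt (Real.log x)) ≤ 1 / 4 := by
  have hx0 : 0 < x := by linarith
  have hlog : 1 ≤ Real.log x := by
    rw [Real.le_log_iff_exp_le hx0]
    exact Real.exp_one_lt_three.le.trans hx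
  have hsqrt : 1 ≤ Real.sqrt (Real.log x) := Real.one_le_sqrt.2 hlog
  have hself := Real.mul_self_sqrt (zero_le_one.trans hlog)
  have hquot : Real.log x * (2 / Real.sqrt (Real.log x)) = 2 * Real.sqrt (Real.log x) := by
    rw [mul_div_assoc', div_eq_iff (by positivity)]
    linarith
  have hexp : Real.log x * (-a - 2 / Real.sqrt (Real.log x)) ≤ -2 := by
    rw [mul_sub, hquot]
    nlinarith
  have h4 : (4 : ℝ) ≤ Real.exp 2 := by
    have h2 : (2 : ℝ) ≤ Real.exp 1 := by linarith [Real.add_one_le_exp (1 : ℝ)]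
    have h3 : Real.exp 2 = Real.exp 1 * Real.exp 1 := by
      rw [← Real.exp_add]
      norm_num
    nlinarith
  rw [Real.rpow_def_of_pos hx0]
  refine (Real.exp_le_exp.2 hexp).trans ?_
  rw [Real.exp_neg, one_div]
  exact inv_anti₀ (by norm_num) h4

theorem theorem1 :
    (∃ c : ℝ, 0 < c ∧ ∀ r : ℕ, 3 ≤ r → c / (r : ℝ) ≤ daisyDensity r 2) ∧
    (∃ C : ℝ, 0 < C ∧ ∀ t : ℕ, 3 ≤ t → ∀ r : ℕ, 3 ≤ r →
      (r : ℝ) ^ (-((4 * (t : ℝ) - 2) / (((2 * t).choose t : ℝ) - 1))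
          - C / Real.sqrt (Real.log (r : ℝ)))
        ≤ daisyDensity r t) := by
  refine ⟨⟨1 / 4, by norm_num, fun r hr => ?_⟩, ⟨2, by norm_num, fun t ht r hr => ?_⟩⟩
  · have h1 : (1 : ℝ) ≤ r := by exact_mod_cast (by omega : 1 ≤ r)
    exact (div_le_self (by norm_num) h1).trans (quarter_le_daisyDensity r 2 le_rfl)
  · refine (rpow_neg_sub_two_div_sqrt_log_le (by exact_mod_cast hr) (div_nonneg ?_ ?_)).trans
      (quarter_le_daisyDensity r t (by omega))
    · have : (3 : ℝ) ≤ t := by exact_mod_cast ht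
      linarith
    · rw [sub_nonneg]
      exact_mod_cast Nat.choose_pos (by omega)
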